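/- Let $\mu,n,r,d$ be positive integers with $r\le n$, $n-r\le d\le n-1$ and $(n-r)(\mu-1)\ge 2$. Put $b=d+1-(n-r)$, $\ell=b^n$ and $N=(r+1)(rn-1-r)+1$. Let $\mathbb F_q$ be a finite field of characteristic $2$ with $q\ge\max\{\mu N,bn\}$, and let $\beta\in\mathbb F_q$ be an element of multiplicative order at least $\max\{\mu N,bn\}$. For $1\le i\le n$, $1\le j\le b$ put $\beta_{i,j}=\beta^{\,i-1+(j-1)n}$; for $0\le a\le\ell-1$ write $a=\sum_{i=1}^n a_i b^{i-1}$ with $0\le a_i\le b-1$ and put $x^{(a)}_i=\beta_{i,a_i+1}$. Let $\mathcal C\subseteq\mathbb F_q^{\ell\times\mu n}$ be the set of arrays, with columns indexed by $(j,i)$, $0\le j\le\mu-1$, $1\le i\le n$, whose row $c^{(a)}$ satisfies, for every $a=0,\dots,\ell-1$, $$\sum_{i=1}^n (x_i^{(a)})^k\,c^{(a)}_{j,i}=0\quad(0\le j\le \mu-1,\ 0\le k\le r-1),$$ $$\sum_{j=0}^{\mu-1}\sum_{i=1}^n (x^{(a)}_i)^r\,c^{(a)}_{j,i}=0,\qquad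 \sum_{j=0}^{\mu-1}\sum_{i=1}^n \beta^{-jN}(x^{(a)}_i)^{-1}c^{(a)}_{j,i}=0 .$$ An $[m,k;\ell]$ array code is an $\mathbb F_q$-linear space of $\ell\times m$ arrays of dimension $k\ell$. It is an $[m,k,\delta;\ell]$ MDS code if moreover $\delta=m-k+1$ is the least number of nonzero columns of a nonzero codeword. For a set $R$ of columns, $\mathcal C|_R$ denotes the restriction of $\mathcal C$ to the columns in $R$. Let $W_j=\{(j,i):1\le i\le n\}$ be the local groups. Then $\mathcal C$ is a locally $d$-MSR $\mathsf{PMDS}(\mu n,\mu,n,r,2;b^n)$ code with partition $W_0,\dots,W_{\mu-1}$, and its local codes are Ye–Barg $d$-MSR codes. That is: 1. $\mathcal C$ is a $[\mu n,(n-r)\mu-2;\ell]$ array code; each local code $\mathcal C|_{W_j}$ is an $[n,n-r,r+1;\ell]$ MDS code; and for all $E_j\subseteq W_j$ with $|E_j|=r$ $(0\le j\le\mu-1)$, the restriction of $\mathcal C$ to the columns outside $\bigcup_j E_j$ is a $[\mu n-r\mu,\mu n-r\mu-2,3;\ell]$ MDS code. 2. Each local code $\mathcal C|_{W_j}$ is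 a $d$-MSR code: the maximum, over all columns $x\in W_j$ and all sets $R\subseteq W_j\setminus\{x\}$ with $|R|=d$, of the smallest total number of symbols of $\mathbb F_q$ that have to be downloaded from the columns in $R$ (each sending arbitrary functions of its own content) to recover column $x$ of every codeword, is $\dfrac{d\,\ell}{1+d-n+r}$. 3. Each local code is an $[n,n-r;b^n]$ Ye–Barg code: there are $bn$ distinct elements $\lambda_{i,u}\in\mathbb F_q$ $(1\le i\le n,\ 0\le u\le b-1)$ such that $\mathcal C|_{W_j}$, with its columns in the order $i=1,\dots,n$, consists of all $\ell\times n$ arrays whose row $c^{(a)}$ satisfies $\sum_{i=1}^n\lambda_{i,a_i}^k c^{(a)}_i=0$ for $0\le k\le r-1$ and all $a$. -/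

import Mathlib

open scoped Matrix

section ArrayCodes

variable {F : Type*} [Field F] {ℓ : ℕ} {ι κ : Type*}

/-- The linear map that sends an array to the array of its columns `e k`, `k : κ`. -/
def selectColumns (F : Type*) [Field F] (ℓ : ℕ) (e : κ → ι) :
    Matrix (Fin ℓ) ι F →ₗ[F] Matrix (Fin ℓ) κ F where
  toFun A := A.submatrix id e
  map_add' _ _ := rfl
  map_smul' _ _ := rfl

/-- The array code obtained by reading the codewords of `C` only in the columns `e k`, `k : κ`. -/
def columnsCode (C : Submodule F (Matrix (Fin ℓ) ι F)) (e : κ → ι) :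
    Submodule F (Matrix (Fin ℓ) κ F) :=
  C.map (selectColumns F ℓ e)

/-- The restriction `C|_R` of an array code to the columns in `R`
(all other columns are punctured). -/
def restrictCode (C : Submodule F (Matrix (Fin ℓ) ι F)) (R : Finset ι) :
    Submodule F (Matrix (Fin ℓ) R F) :=
  columnsCode C (fun j : R => (j : ι))

open Classical in
/-- The number of nonzero columns of an array: its Hamming weight over the alphabet `F ^ ℓ`. -/
noncomputable def columnWeight [Fintype ι] (A : Matrix (Fin ℓ) ι F) : ℕ :=
  hammingNorm A.col

/-- `C` is a linear `[n, k; ℓ]` array code: it has `n` columns and `ℓ` rows, and dimension `k` over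
the alphabet `F ^ ℓ`, that is, dimension `k * ℓ` over `F`. -/
structure IsArrayCode [Fintype ι] (C : Submodule F (Matrix (Fin ℓ) ι F)) (n k : ℕ) : Prop where
  length_eq : Fintype.card ι = n
  finrank_eq : Module.finrank F C = k * ℓ

/-- `C` is an `[n, k, δ; ℓ]` MDS array code: its minimum distance (the least number of nonzero
columns of a nonzero codeword) is `δ`, and the Singleton bound `δ ≤ n - k + 1` is attained. -/
structure IsMDSArrayCode [Fintype ι] (C : Submodule F (Matrix (Fin ℓ) ι F)) (n k δ : ℕ) : Prop
    extends IsArrayCode C n k where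
  minDist_eq : IsLeast {w : ℕ | ∃ A ∈ C, A ≠ 0 ∧ columnWeight A = w} δ
  singleton_eq : k + δ = n + 1

/-- `C` is a `PMDS(μ n, μ, n, r, s; ℓ)` partial MDS array code with respect to the partition
`W 0, …, W (μ - 1)` of its columns. -/
structure IsPMDSWith [Fintype ι] [DecidableEq ι] (C : Submodule F (Matrix (Fin ℓ) ι F))
    (μ n r s : ℕ) (W : Fin μ → Finset ι) : Prop where
  μ_pos : 0 < μ
  n_pos : 0 < n
  r_pos : 0 < r
  s_pos : 0 < s
  ℓ_pos : 0 < ℓ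
  r_le : r ≤ n
  s_le : s ≤ (n - r) * μ
  isArrayCode : IsArrayCode C (μ * n) ((n - r) * μ - s)
  card_part : ∀ i, (W i).card = n
  disjoint_parts : Pairwise fun i j => Disjoint (W i) (W j)
  union_parts : Finset.univ.biUnion W = Finset.univ
  local_mds : ∀ i, IsMDSArrayCode (restrictCode C (W i)) n (n - r) (r + 1)
  global_mds : ∀ E : Fin μ → Finset ι, (∀ i, E i ⊆ W i) → (∀ i, (E i).card = r) →
    IsMDSArrayCode (restrictCode C (Finset.univ \ Finset.univ.biUnion E))
      (μ * n - r * μ) (μ * n - r * μ - s) (s + 1)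

/-- The columns in `X` of every codeword of `C` can be recovered when each helper column `j ∈ R`
transmits `m j` symbols of `F`, computed from the content of this column alone. -/
def CanRepair (C : Submodule F (Matrix (Fin ℓ) ι F)) (X R : Finset ι) (m : R → ℕ) : Prop :=
  ∃ (f : (j : R) → (Fin ℓ → F) → (Fin (m j) → F))
    (g : ((j : R) → Fin (m j) → F) → (X → Fin ℓ → F)),
    ∀ A ∈ C, ∀ x : X, g (fun j => f j (A.col j)) x = A.col x

/-- The smallest number of symbols of `F` that one needs to download from the columns in `R` to
recover the erased columns in `X`. -/
noncomputable def repairBandwidth (C : Submodule F (Matrix (Fin ℓ) ι F)) (X R : Finset ι) : ℕ :=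
  sInf {t : ℕ | ∃ m : R → ℕ, CanRepair C X R m ∧ t = ∑ j, m j}

/-- `C` is an `(h, d)`-MSR code with parameters `[n, n - r; ℓ]`. The conditions `h ≤ r`,
`n - r ≤ d` and the MDS property guarantee that repair is possible for all `X` and `R` below. -/
structure IsMSR [Fintype ι] (C : Submodule F (Matrix (Fin ℓ) ι F)) (n r h d : ℕ) : Prop where
  mds : IsMDSArrayCode C n (n - r) (r + 1)
  h_pos : 0 < h
  h_le : h ≤ r
  le_d : n - r ≤ d
  max_bandwidth : IsGreatest
    {x : ℚ | ∃ X R : Finset ι, X.card = h ∧ R.card = d ∧ Disjoint X R ∧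
      x = (repairBandwidth C X R : ℚ)}
    ((h : ℚ) * d * ℓ / ((h : ℚ) + d - n + r))

/-- A `PMDS(μ n, μ, n, r, s; ℓ)` code with partition `W` is locally `(h, d)`-MSR if all its local
codes `C|_{W i}` are `(h, d)`-MSR codes. -/
structure IsLocallyMSRPMDS [Fintype ι] [DecidableEq ι] (C : Submodule F (Matrix (Fin ℓ) ι F))
    (μ n r s h d : ℕ) (W : Fin μ → Finset ι) : Prop where
  pmds : IsPMDSWith C μ n r s W
  local_msr : ∀ i, IsMSR (restrictCode C (W i)) n r h d

/-- The array code whose row `a` is the kernel of the parity-check matrix `H a`. -/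
def rowwiseCode {m : Type*} [Fintype ι] (H : Fin ℓ → Matrix m ι F) :
    Submodule F (Matrix (Fin ℓ) ι F) where
  carrier := {A | ∀ a, H a *ᵥ A.row a = 0}
  zero_mem' a := Matrix.mulVec_zero (H a)
  add_mem' {A B} hA hB a := by
    have h : H a *ᵥ (A.row a + B.row a) = 0 := by rw [Matrix.mulVec_add, hA a, hB a, add_zero]
    exact h
  smul_mem' c A hA a := by
    have h : H a *ᵥ (c • A.row a) = 0 := by rw [Matrix.mulVec_smul, hA a, smul_zero]
    exact h

end ArrayCodes

section Constructions

variable {F : Type*} [Field F]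

/-- The digit `a_i` in the expansion `a = ∑ i, a_i * b ^ i` to the base `b`, where
`i = 0, …, n - 1` and `0 ≤ a_i < b`. -/
def digit {n b : ℕ} (a : Fin (b ^ n)) (i : Fin n) : Fin b :=
  finFunctionFinEquiv.symm a i

/-- The `r × n` Vandermonde matrix with entries `(lam i (a_i)) ^ k`, `0 ≤ k < r`. -/
def vandermondeCheck {n b : ℕ} (r : ℕ) (lam : Fin n → Fin b → F) (a : Fin (b ^ n)) :
    Matrix (Fin r) (Fin n) F :=
  Matrix.of fun k i => lam i (digit a i) ^ (k : ℕ)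

/-- `C` is an `[n, n - r; b ^ n]` Ye–Barg `d`-MSR code, `b = d + 1 - n + r`: for some `b * n`
distinct elements `lam i j` of `F`, it consists of the arrays whose row `a` satisfies the parity
checks `∑ i, (lam i (a_i)) ^ k * c_i = 0` for `0 ≤ k < r`. -/
def IsYeBarg {n b : ℕ} (C : Submodule F (Matrix (Fin (b ^ n)) (Fin n) F)) (r d : ℕ) : Prop :=
  b + n = d + 1 + r ∧ IsArrayCode C n (n - r) ∧
    ∃ lam : Fin n → Fin b → F, Function.Injective (fun p : Fin n × Fin b => lam p.1 p.2) ∧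
      C = rowwiseCode (vandermondeCheck r lam)

/-- The code locators `β ^ (i + j * n)`, with both `i` and `j` counted from `0`. -/
def locator {n b : ℕ} (β : F) (i : Fin n) (j : Fin b) : F :=
  β ^ ((i : ℕ) + (j : ℕ) * n)

/-- The two global parity checks on local group `j` (counted from `0`), in row `a`. -/
def globalCheck {n b : ℕ} (r N : ℕ) (β : F) (j : ℕ) (a : Fin (b ^ n)) :
    Matrix (Fin 2) (Fin n) F :=
  Matrix.of ![fun i => locator β i (digit a i) ^ r,
    fun i => β ^ (-((j * N : ℕ) : ℤ)) * (locator β i (digit a i))⁻¹]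

/-- The `(r μ + 2) × μ n` parity-check matrix of row `a`: `μ` diagonal copies of the local
parity-check matrix, above the two rows of global parity checks. Column `(j, i)` is the `i`-th
column of the `j`-th local group. -/
def parityCheck (μ : ℕ) {n b : ℕ} (r N : ℕ) (β : F) (a : Fin (b ^ n)) :
    Matrix ((Fin μ × Fin r) ⊕ Fin 2) (Fin μ × Fin n) F :=
  Matrix.of fun ρ c =>
    match ρ with
    | Sum.inl (j, k) => if j = c.1 then vandermondeCheck r (locator β) a k c.2 else 0
    | Sum.inr t => globalCheck r N β (c.1 : ℕ) a t c.2

/-- The array code with `b ^ n` rows and `μ n` columns defined by the matrices `parityCheck`. -/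
def twoParityCode (μ n b r N : ℕ) (β : F) :
    Submodule F (Matrix (Fin (b ^ n)) (Fin μ × Fin n) F) :=
  rowwiseCode (fun a => parityCheck μ r N β a)

/-- The set of the `n` columns of local group `j`. -/
def localGroup (μ n : ℕ) (j : Fin μ) : Finset (Fin μ × Fin n) :=
  {j} ×ˢ Finset.univ

end Constructions

open scoped Matrix

/-! ### Moments of vectors with given locators -/

section Moments

variable {F : Type*} [Field F] {ι : Type*} [Fintype ι]

/-! Everything is checked row by row; in a row the locators `x i` are distinct. The core is
`eq_zero_of_parityCheck_mulVec`: the parity checks of a row are injective on vectors supported on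
`r` columns of each group and two more columns `p`, `q`. These are `r μ + 2` columns, as many as
there are checks, so this gives the dimension, the extension of local words to codewords, and
distance 3 after puncturing.

Groups without `p`, `q` vanish by Vandermonde. If `p`, `q` share a group, the moments of order `-1,
…, r` all vanish there, on at most `r + 2` columns. Otherwise each of the two groups has support in
`r + 1` columns, and the polynomial with these locators as roots ties moment `r` to moment `-1`. The
global checks become a 2×2 system that is singular only if `β ^ (j N) ∏_T x = β ^ (j' N) ∏_T' x`.
Exponent sums of two `(r + 1)`-sets differ by less than `N`, so these exponents are distinct and
differ by less than `μ N ≤ orderOf β`.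

Local codes are Ye–Barg codes. Summing over the `b` rows that differ only in the digit of the erased
column leaves `b` unknown symbols and `n - 1 - d` unknown sums, `r` in all, which the `r` moments
determine; so `b ^ (n - 1)` symbols per helper suffice. Conversely any `b` helpers must send `b ^ n`
symbols (cut-set bound), and averaging gives `d * b ^ (n - 1)`. -/

theorem sum_mul_eval_eq_zero {v x : ι → F} {r : ℕ} (h : ∀ k < r, ∑ i, x i ^ k * v i = 0)
    {p : Polynomial F} (hp : p.natDegree < r) : ∑ i, v i * p.eval (x i) = 0 := by
  simp only [Polynomial.eval_eq_sum_range' hp, Finset.mul_sum]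
  rw [Finset.sum_comm]
  refine Finset.sum_eq_zero fun k hk => ?_
  have := h k (Finset.mem_range.1 hk)
  calc _ = p.coeff k * ∑ i, x i ^ k * v i := by
        rw [Finset.mul_sum]; exact Finset.sum_congr rfl fun i _ => by ring
    _ = 0 := by rw [this, mul_zero]

/-- A vector supported on at most `r` coordinates with distinct locators vanishes as soon as its
first `r` moments vanish. -/
theorem eq_zero_of_moments {v x : ι → F} {r : ℕ} {S : Finset ι} (hx : Set.InjOn x S)
    (hv : ∀ i ∉ S, v i = 0) (hS : S.card ≤ r) (h : ∀ k < r, ∑ i, x i ^ k * v i = 0) :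
    v = 0 := by
  classical
  funext i
  by_cases hi : i ∈ S
  swap
  · exact hv i hi
  -- Testing against the polynomial with roots at all locators of `S` but that of `i` isolates `v
  -- i`.
  have hdeg : (∏ l ∈ S.erase i, (Polynomial.X - Polynomial.C (x l))).natDegree < r := by
    rw [Polynomial.natDegree_finsetProd_X_sub_C_eq_card, Finset.card_erase_of_mem hi]
    have := Finset.card_pos.2 ⟨i, hi⟩
    omega
  have h1 := sum_mul_eval_eq_zero h hdeg
  rw [Finset.sum_eq_single i] at h1
  · rcases mul_eq_zero.1 h1 with h2 | h2
    · exact h2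
    · rw [Polynomial.eval_prod, Finset.prod_eq_zero_iff] at h2
      obtain ⟨l, hl, h3⟩ := h2
      simp only [Polynomial.eval_sub, Polynomial.eval_X, Polynomial.eval_C, sub_eq_zero] at h3
      exact absurd (hx hi (Finset.mem_of_mem_erase hl) h3).symm (Finset.ne_of_mem_erase hl)
  · intro l _ hl
    by_cases hlS : l ∈ S
    · rw [Polynomial.eval_prod, Finset.prod_eq_zero (Finset.mem_erase.2 ⟨hl, hlS⟩) (by simp),
        mul_zero]
    · rw [hv l hlS, zero_mul]
  · simp

/-- For a vector supported on `r + 1` coordinates whose moments of order `0, …, r - 1` vanish, the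
moment of order `r` is proportional to the moment of order `-1`. -/
theorem moment_add_prod_mul_moment_inv {v x : ι → F} {r : ℕ} {S : Finset ι} (hx : ∀ i, x i ≠ 0)
    (hv : ∀ i ∉ S, v i = 0) (hS : S.card = r + 1) (h : ∀ k < r, ∑ i, x i ^ k * v i = 0) :
    ∑ i, x i ^ r * v i + (∏ i ∈ S, -x i) * ∑ i, (x i)⁻¹ * v i = 0 := by
  set p : Polynomial F := ∏ l ∈ S, (Polynomial.X - Polynomial.C (x l)) with hp
  have hdeg : p.natDegree = r + 1 := by
    rw [hp, Polynomial.natDegree_finsetProd_X_sub_C_eq_card, hS]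
  have hlead : p.coeff (r + 1) = 1 := by
    have : p.Monic := Polynomial.monic_prod_of_monic _ _ fun i _ => Polynomial.monic_X_sub_C _
    rw [← hdeg]; exact this
  have h0 : p.coeff 0 = ∏ i ∈ S, -x i := by
    rw [Polynomial.coeff_zero_eq_eval_zero, hp, Polynomial.eval_prod]
    simp
  have hz : ∑ i, (x i)⁻¹ * v i * p.eval (x i) = 0 := by
    refine Finset.sum_eq_zero fun i _ => ?_
    by_cases hi : i ∈ S
    · rw [hp, Polynomial.eval_prod, Finset.prod_eq_zero hi (by simp), mul_zero]
    · rw [hv i hi, mul_zero, zero_mul]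
  -- Dividing `p` by `X` shifts exponents down by one: the leading term gives moment `r`, the
  -- constant term moment `-1`, and the rest lies in orders `0, …, r - 1`.
  have hexp : ∀ i, (x i)⁻¹ * v i * p.eval (x i) =
      (x i ^ r * v i + (∏ l ∈ S, -x l) * ((x i)⁻¹ * v i)) +
        ∑ k ∈ Finset.range r, p.coeff (k + 1) * (x i ^ k * v i) := by
    intro i
    rw [Polynomial.eval_eq_sum_range' (show p.natDegree < r + 1 + 1 by omega),
      Finset.sum_range_succ, Finset.sum_range_succ', hlead, h0]
    have e1 : ∑ k ∈ Finset.range r, p.coeff (k + 1) * x i ^ (k + 1) =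
        x i * ∑ k ∈ Finset.range r, p.coeff (k + 1) * x i ^ k := by
      rw [Finset.mul_sum]; exact Finset.sum_congr rfl fun k _ => by ring
    have e2 : ∑ k ∈ Finset.range r, p.coeff (k + 1) * (x i ^ k * v i) =
        (∑ k ∈ Finset.range r, p.coeff (k + 1) * x i ^ k) * v i := by
      rw [Finset.sum_mul]; exact Finset.sum_congr rfl fun k _ => by ring
    rw [e1, e2]
    field_simp [hx i]
    ring
  simp only [hexp, Finset.sum_add_distrib] at hz
  rw [Finset.sum_comm (s := Finset.univ) (t := Finset.range r)] at hz
  rw [Finset.mul_sum]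
  have h2 : ∑ k ∈ Finset.range r, ∑ i, p.coeff (k + 1) * (x i ^ k * v i) = 0 :=
    Finset.sum_eq_zero fun k hk => by
      rw [← Finset.mul_sum, h k (Finset.mem_range.1 hk), mul_zero]
  rwa [h2, add_zero] at hz

end Moments

/-! ### Row-wise codes, dimension and the Singleton bound -/

section LinearAlgebra

theorem mem_rowwiseCode {F : Type*} [Field F] {ι m : Type*} [Fintype ι] {ℓ : ℕ}
    {H : Fin ℓ → Matrix m ι F} {A : Matrix (Fin ℓ) ι F} :
    A ∈ rowwiseCode H ↔ ∀ a, H a *ᵥ A a = 0 := Iff.rfl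

variable {F : Type*} [Field F] {ι : Type*} [Fintype ι] {m : Type*} [Fintype m]

/-- If the columns in `S` of a matrix form a nonsingular square matrix, then every right-hand side
is attained by a vector supported on `S`. -/
theorem exists_mulVec_eq_of_injOn {H : Matrix m ι F} {S : Finset ι}
    (hS : S.card = Fintype.card m)
    (hinj : ∀ v : ι → F, (∀ i ∉ S, v i = 0) → H *ᵥ v = 0 → v = 0) (y : m → F) :
    ∃ v : ι → F, (∀ i ∉ S, v i = 0) ∧ H *ᵥ v = y := by
  classical
  let ext : (S → F) →ₗ[F] (ι → F) :=
    { toFun := fun u i => if h : i ∈ S then u ⟨i, h⟩ else 0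
      map_add' := fun u w => by ext i; by_cases h : i ∈ S <;> simp [h]
      map_smul' := fun c u => by ext i; by_cases h : i ∈ S <;> simp [h] }
  have hext : ∀ u, ∀ i ∉ S, ext u i = 0 := fun u i hi => by simp [ext, hi]
  have hker : Function.Injective (H.mulVecLin ∘ₗ ext) := by
    rw [← LinearMap.ker_eq_bot, LinearMap.ker_eq_bot']
    intro u hu
    have h1 := hinj (ext u) (hext u) hu
    ext i
    have := congrFun h1 i
    simpa [ext] using this
  have hsurj := (LinearMap.injective_iff_surjective_of_finrank_eq_finrank
    (f := H.mulVecLin ∘ₗ ext) (by simp [hS])).1 hker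
  obtain ⟨u, hu⟩ := hsurj y
  exact ⟨ext u, hext u, hu⟩

/-- If the columns in `S` of a parity-check matrix form a nonsingular square matrix, then the
coordinates outside `S` of a word of the code can be prescribed. -/
theorem exists_mulVec_eq_zero_eqOn {H : Matrix m ι F} {S : Finset ι}
    (hS : S.card = Fintype.card m)
    (hinj : ∀ v : ι → F, (∀ i ∉ S, v i = 0) → H *ᵥ v = 0 → v = 0) (v₀ : ι → F) :
    ∃ v : ι → F, (∀ i ∉ S, v i = v₀ i) ∧ H *ᵥ v = 0 := by
  obtain ⟨w, hw, hHw⟩ := exists_mulVec_eq_of_injOn hS hinj (-(H *ᵥ v₀))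
  refine ⟨v₀ + w, fun i hi => by simp [hw i hi], ?_⟩
  rw [Matrix.mulVec_add, hHw, add_neg_cancel]

variable {ℓ : ℕ}

theorem finrank_rowwiseCode {H : Fin ℓ → Matrix m ι F}
    (hH : ∀ a, ∀ y : m → F, ∃ v, H a *ᵥ v = y) :
    Module.finrank F (rowwiseCode H) = (Fintype.card ι - Fintype.card m) * ℓ := by
  let Φ : Matrix (Fin ℓ) ι F →ₗ[F] (Fin ℓ → m → F) :=
    { toFun := fun A a => H a *ᵥ A a
      map_add' := fun A B => by ext1 a; exact Matrix.mulVec_add (H a) (A a) (B a)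
      map_smul' := fun c A => by ext1 a; exact Matrix.mulVec_smul (H a) c (A a) }
  have hker : LinearMap.ker Φ = rowwiseCode H := by
    ext A
    rw [LinearMap.mem_ker, mem_rowwiseCode]
    exact funext_iff
  have hsurj : LinearMap.range Φ = ⊤ := by
    rw [LinearMap.range_eq_top]
    intro y
    choose v hv using fun a => hH a (y a)
    exact ⟨v, funext hv⟩
  have h := LinearMap.finrank_range_add_finrank_ker Φ
  rw [hsurj, hker, finrank_top] at h
  simp only [Module.finrank_pi_fintype, Module.finrank_matrix, Module.finrank_self,
    Finset.sum_const, Finset.card_univ, Fintype.card_fin, smul_eq_mul, mul_one] at h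
  rw [Nat.sub_mul]
  have e1 := mul_comm ℓ (Fintype.card m)
  have e2 := mul_comm ℓ (Fintype.card ι)
  omega

theorem columnWeight_le_card {A : Matrix (Fin ℓ) ι F} {S : Finset ι}
    (h : ∀ i ∉ S, ∀ a, A a i = 0) : columnWeight A ≤ S.card := by
  classical
  unfold columnWeight hammingNorm
  refine Finset.card_le_card fun i hi => ?_
  by_contra hiS
  exact (Finset.mem_filter.1 hi).2 (funext fun a => h i hiS a)

theorem exists_card_eq_columnWeight (A : Matrix (Fin ℓ) ι F) :
    ∃ S : Finset ι, S.card = columnWeight A ∧ ∀ i ∉ S, ∀ a, A a i = 0 := by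
  classical
  refine ⟨Finset.univ.filter fun i => A.col i ≠ 0, ?_, fun i hi a => ?_⟩
  · unfold columnWeight hammingNorm
    congr
  · simp only [Finset.mem_filter, Finset.mem_univ, true_and, not_not] at hi
    exact congrFun hi a

/-- The Singleton bound for array codes. -/
theorem exists_columnWeight_le {C : Submodule F (Matrix (Fin ℓ) ι F)} {n k δ : ℕ}
    (hC : IsArrayCode C n k) (hk : 0 < k) (hℓ : 0 < ℓ) (hkn : k + δ = n + 1) :
    ∃ A ∈ C, A ≠ 0 ∧ columnWeight A ≤ δ := by
  classical
  obtain ⟨T, -, hT⟩ := Finset.exists_subset_card_eq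
    (show k - 1 ≤ (Finset.univ : Finset ι).card by rw [Finset.card_univ, hC.length_eq]; omega)
  -- Reading only `k - 1` columns cannot be injective, and a word in the kernel has weight at most
  -- `n - k + 1 = δ`.
  let f : C →ₗ[F] Matrix (Fin ℓ) T F := (selectColumns F ℓ (fun j : T => (j : ι))).domRestrict C
  have hlt : Module.finrank F (Matrix (Fin ℓ) T F) < Module.finrank F C := by
    rw [hC.finrank_eq, Module.finrank_matrix]
    simp only [Fintype.card_fin, Fintype.card_coe, Module.finrank_self, mul_one, hT]
    rw [mul_comm]
    exact Nat.mul_lt_mul_of_pos_right (by omega) hℓ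
  have hne := LinearMap.ker_ne_bot_of_finrank_lt hlt (f := f)
  obtain ⟨⟨A, hA⟩, hfA, hA0⟩ := Submodule.exists_mem_ne_zero_of_ne_bot hne
  refine ⟨A, hA, fun h => hA0 (Subtype.ext h), ?_⟩
  have hz : ∀ i ∉ Tᶜ, ∀ a, A a i = 0 := fun i hi a => by
    have h1 : f ⟨A, hA⟩ = 0 := hfA
    have h2 := congrFun (congrFun h1 a) ⟨i, by simpa using hi⟩
    exact h2
  have := columnWeight_le_card hz
  rw [Finset.card_compl, hT, hC.length_eq] at this
  omega

/-- The Singleton bound supplies a word of weight at most `δ`, so only the lower bound on weights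
remains to be checked in applications. -/
theorem isMDSArrayCode_of_le_columnWeight {C : Submodule F (Matrix (Fin ℓ) ι F)} {n k δ : ℕ}
    (hC : IsArrayCode C n k) (hk : 0 < k) (hℓ : 0 < ℓ) (hkn : k + δ = n + 1)
    (hδ : ∀ A ∈ C, A ≠ 0 → δ ≤ columnWeight A) : IsMDSArrayCode C n k δ where
  toIsArrayCode := hC
  minDist_eq := by
    obtain ⟨A, hA, hA0, hw⟩ := exists_columnWeight_le hC hk hℓ hkn
    refine ⟨⟨A, hA, hA0, le_antisymm hw (hδ A hA hA0)⟩, ?_⟩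
    rintro w ⟨B, hB, hB0, rfl⟩
    exact hδ B hB hB0
  singleton_eq := hkn

end LinearAlgebra

/-! ### An averaging inequality -/

section Averaging

/-- The `b` smallest values of a function have at most the average sum. -/
theorem exists_subset_card_eq_sum_le {α : Type*} (m : α → ℕ) {b : ℕ} (s : Finset α)
    (hb : b ≤ s.card) : ∃ B ⊆ s, B.card = b ∧ s.card * ∑ j ∈ B, m j ≤ b * ∑ j ∈ s, m j := by
  classical
  induction h : s.card - b generalizing s with
  | zero =>
    have hs : s.card = b := by omega
    exact ⟨s, subset_rfl, hs, by rw [hs]⟩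
  | succ c ih =>
    -- Discarding a largest value does not raise the average.
    obtain ⟨x, hx, hmax⟩ := s.exists_max_image m (Finset.card_pos.1 (by omega))
    have hcard := Finset.card_erase_add_one hx
    obtain ⟨B, hB, hBc, hle⟩ := ih (s.erase x) (by omega) (by omega)
    refine ⟨B, hB.trans (Finset.erase_subset _ _), hBc, ?_⟩
    have h1 : ∑ j ∈ B, m j ≤ b * m x := by
      rw [← hBc, ← smul_eq_mul]
      exact Finset.sum_le_card_nsmul _ _ _ fun j hj => hmax j (Finset.mem_of_mem_erase (hB hj))
    rw [← hcard, ← Finset.sum_erase_add s m hx, add_mul, mul_add, one_mul]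
    exact add_le_add hle h1

end Averaging

/-! ### Repair schemes and the cut-set bound -/

section Repair

variable {F : Type*} [Field F] {ℓ : ℕ} {ι : Type*}

/-- The decoder may be any function: it picks some codeword consistent with the downloads. -/
theorem canRepair_of_determines {C : Submodule F (Matrix (Fin ℓ) ι F)} {X R : Finset ι}
    {m : R → ℕ} (f : (j : R) → (Fin ℓ → F) → (Fin (m j) → F))
    (hf : ∀ A ∈ C, ∀ B ∈ C, (∀ j : R, f j (A.col j) = f j (B.col j)) →
      ∀ x ∈ X, A.col x = B.col x) : CanRepair C X R m := by
  classical
  refine ⟨f, fun M => if h : ∃ A ∈ C, (fun j : R => f j (A.col j)) = M then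
    fun x => h.choose.col x else 0, fun A hA x => ?_⟩
  have h : ∃ B ∈ C, (fun j : R => f j (B.col j)) = fun j : R => f j (A.col j) := ⟨A, hA, rfl⟩
  beta_reduce
  rw [dif_pos h]
  exact hf _ h.choose_spec.1 A hA (fun j => congrFun h.choose_spec.2 j) x x.2

/-- The cut-set bound: if the column `x` can take any value in codewords which vanish in the
helper columns outside `B`, then the helpers in `B` transmit at least `ℓ` symbols. -/
theorem le_sum_of_canRepair [Fintype F] {C : Submodule F (Matrix (Fin ℓ) ι F)} {x : ι}
    {R : Finset ι} {m : R → ℕ} (hC : CanRepair C {x} R m) (B : Finset R)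
    (hB : ∀ w : Fin ℓ → F, ∃ A ∈ C, A.col x = w ∧ ∀ j : R, j ∉ B → A.col j = 0) :
    ℓ ≤ ∑ j ∈ B, m j := by
  classical
  obtain ⟨f, g, hfg⟩ := hC
  choose A hA hAx hA0 using hB
  -- Helpers outside `B` see a zero column whatever `w` is, so what `B` sends must distinguish all
  -- `w`.
  have hinj : Function.Injective
      (fun (w : Fin ℓ → F) (j : B) => f j ((A w).col (j : R))) := by
    intro w w' hw
    have hall : (fun j : R => f j ((A w).col j)) = fun j : R => f j ((A w').col j) := by
      funext j
      by_cases hj : j ∈ B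
      · exact congrFun hw ⟨j, hj⟩
      · rw [hA0 w j hj, hA0 w' j hj]
    have h1 := hfg _ (hA w) ⟨x, Finset.mem_singleton_self x⟩
    have h2 := hfg _ (hA w') ⟨x, Finset.mem_singleton_self x⟩
    rw [hall, h2] at h1
    exact (hAx w).symm.trans (h1.symm.trans (hAx w'))
  have hcard := Fintype.card_le_of_injective _ hinj
  simp only [Fintype.card_pi, Finset.prod_const, Finset.card_univ, Fintype.card_fin] at hcard
  rw [Finset.prod_pow_eq_pow_sum, Finset.sum_coe_sort B m] at hcard
  exact (Nat.pow_le_pow_iff_right Fintype.one_lt_card).1 hcard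

end Repair

/-! ### Ye–Barg codes: MDS property and optimal repair -/

section YeBarg

theorem locators_injective {F ι : Type*} {n b : ℕ} {lam : Fin n → Fin b → F}
    (hlam : Function.Injective fun p : Fin n × Fin b => lam p.1 p.2)
    (e : ι ≃ Fin n) (c : Fin n → Fin b) : Function.Injective fun i => lam (e i) (c (e i)) := by
  intro i i' h
  have := hlam (a₁ := (e i, c (e i))) (a₂ := (e i', c (e i'))) h
  exact e.injective (Prod.ext_iff.1 this).1

variable {F : Type*} [Field F] {ι : Type*} [Fintype ι] {n b r : ℕ}

/-- The code whose row `a` has the locators `lam i (a_i)`, with columns relabelled along `e`. -/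
def yeBargCode (r : ℕ) (lam : Fin n → Fin b → F) (e : ι ≃ Fin n) :
    Submodule F (Matrix (Fin (b ^ n)) ι F) :=
  rowwiseCode fun a => (vandermondeCheck r lam a).submatrix id e

variable {lam : Fin n → Fin b → F} {e : ι ≃ Fin n}

theorem mem_yeBargCode {A : Matrix (Fin (b ^ n)) ι F} : A ∈ yeBargCode r lam e ↔
    ∀ a, ∀ k < r, ∑ i, lam (e i) (digit a (e i)) ^ k * A a i = 0 := by
  refine mem_rowwiseCode.trans (forall_congr' fun a => ?_)
  rw [funext_iff]
  exact ⟨fun h k hk => h ⟨k, hk⟩, fun h k => h k k.2⟩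

theorem eq_zero_of_vandermondeCheck_mulVec
    (hlam : Function.Injective fun p : Fin n × Fin b => lam p.1 p.2) {a : Fin (b ^ n)}
    {v : ι → F} {S : Finset ι} (hS : S.card ≤ r) (hv : ∀ i ∉ S, v i = 0)
    (h : (vandermondeCheck r lam a).submatrix id e *ᵥ v = 0) : v = 0 :=
  eq_zero_of_moments (locators_injective hlam e (digit a)).injOn hv hS
    fun k hk => congrFun h ⟨k, hk⟩

/-- Any `n - r` columns form an information set; the cut-set bound needs this. -/
theorem exists_mem_yeBargCode_eqOn
    (hlam : Function.Injective fun p : Fin n × Fin b => lam p.1 p.2) {T : Finset ι}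
    (hT : T.card = r) (A₀ : Matrix (Fin (b ^ n)) ι F) :
    ∃ A ∈ yeBargCode r lam e, ∀ a, ∀ i ∉ T, A a i = A₀ a i := by
  have h := fun a => exists_mulVec_eq_zero_eqOn (H := (vandermondeCheck r lam a).submatrix id e)
    (S := T) (by simpa using hT)
    (fun v hv hz => eq_zero_of_vandermondeCheck_mulVec hlam hT.le hv hz) (A₀ a)
  choose A hA hz using h
  exact ⟨A, mem_rowwiseCode.2 hz, hA⟩

theorem isArrayCode_yeBargCode
    (hlam : Function.Injective fun p : Fin n × Fin b => lam p.1 p.2) (hr : r ≤ n) :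
    IsArrayCode (yeBargCode r lam e) n (n - r) where
  length_eq := by simpa using Fintype.card_congr e
  finrank_eq := by
    have hcard : Fintype.card ι = n := by simpa using Fintype.card_congr e
    obtain ⟨T, -, hT⟩ := Finset.exists_subset_card_eq
      (show r ≤ (Finset.univ : Finset ι).card by rwa [Finset.card_univ, hcard])
    have h := finrank_rowwiseCode (H := fun a => (vandermondeCheck r lam a).submatrix id e)
      fun a y => by
        obtain ⟨v, -, hv⟩ := exists_mulVec_eq_of_injOn (S := T) (by simpa using hT)
          (fun v hv hz => eq_zero_of_vandermondeCheck_mulVec hlam hT.le hv hz) y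
        exact ⟨v, hv⟩
    rw [hcard, Fintype.card_fin] at h
    exact h

theorem isMDSArrayCode_yeBargCode
    (hlam : Function.Injective fun p : Fin n × Fin b => lam p.1 p.2) (hr : r < n) (hb : 0 < b) :
    IsMDSArrayCode (yeBargCode r lam e) n (n - r) (r + 1) := by
  refine isMDSArrayCode_of_le_columnWeight (isArrayCode_yeBargCode hlam hr.le) (by omega)
    (Nat.pow_pos hb) (by omega) fun A hA hA0 => ?_
  by_contra hlt
  obtain ⟨S, hS, hSz⟩ := exists_card_eq_columnWeight A
  refine hA0 (funext fun a => ?_)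
  exact eq_zero_of_vandermondeCheck_mulVec hlam (by omega) (fun i hi => hSz i hi a)
    (mem_rowwiseCode.1 hA a)

/-- The row obtained from `a` by changing the digit at position `i₀` to `u`. -/
def setDigit (i₀ : Fin n) (a : Fin (b ^ n)) (u : Fin b) : Fin (b ^ n) :=
  finFunctionFinEquiv (Function.update (digit a) i₀ u)

theorem digit_setDigit (i₀ : Fin n) (a : Fin (b ^ n)) (u : Fin b) :
    digit (setDigit i₀ a u) = Function.update (digit a) i₀ u := by
  funext i
  simp [digit, setDigit]

theorem setDigit_digit (i₀ : Fin n) (a : Fin (b ^ n)) : setDigit i₀ a (digit a i₀) = a := by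
  unfold setDigit
  rw [Function.update_eq_self]
  exact finFunctionFinEquiv.apply_symm_apply a

/-- The rows fall into `b ^ (n - 1)` classes of rows that differ only at position `i₀`. -/
theorem exists_setDigit_representatives (hb : 0 < b) (i₀ : Fin n) :
    ∃ ρ : Fin (b ^ (n - 1)) → Fin (b ^ n), ∀ a, ∃ t, ∀ u, setDigit i₀ (ρ t) u =
      setDigit i₀ a u := by
  have hc : Fintype.card (Fin (b ^ (n - 1))) = Fintype.card ({i : Fin n // i ≠ i₀} → Fin b) := by
    simp
  let E := Fintype.equivOfCardEq hc
  -- The digit 0 at `i₀` is arbitrary, since `setDigit` overwrites it.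
  refine ⟨fun t => finFunctionFinEquiv fun i => if h : i ≠ i₀ then E t ⟨i, h⟩ else ⟨0, hb⟩,
    fun a => ⟨E.symm fun i => digit a i, fun u => ?_⟩⟩
  unfold setDigit
  congr 1
  funext i
  by_cases h : i = i₀
  · subst h; simp
  · simp [h, digit]

/-- If, in all classes of rows, the helper columns of a codeword sum to zero, then so does the
column under repair, entry by entry. -/
theorem yeBargCode_column_eq_zero [DecidableEq ι] {d : ℕ}
    (hlam : Function.Injective fun p : Fin n × Fin b => lam p.1 p.2) (hbd : b + n = d + 1 + r)
    {x : ι} {R : Finset ι} (hxR : x ∉ R) (hR : R.card = d) {A : Matrix (Fin (b ^ n)) ι F}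
    (hA : A ∈ yeBargCode r lam e) (a : Fin (b ^ n))
    (hz : ∀ i ∈ R, ∑ u, A (setDigit (e x) a u) i = 0) : A a x = 0 := by
  have hcard : Fintype.card ι = n := by simpa using Fintype.card_congr e
  -- Only column `x` changes its locator within a class of rows. Summing the checks over the class
  -- yields one word with `b` coordinates for `x` and one summed coordinate for every other column.
  let loc : Fin b ⊕ ι → F := Sum.elim (fun u => lam (e x) u) fun i => lam (e i) (digit a (e i))
  let vec : Fin b ⊕ ι → F := Sum.elim (fun u => A (setDigit (e x) a u) x)
    fun i => if i = x then 0 else ∑ u, A (setDigit (e x) a u) i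
  have hvec : vec = 0 := by
    -- The support has size `b + (n - 1 - d) = r`. `S` must omit `Sum.inr x`, whose locator repeats
    -- one of the `b` locators of column `x`; `vec` is set to zero there.
    refine eq_zero_of_moments (x := loc) (r := r)
      (S := Finset.univ.disjSum (Finset.univ \ insert x R)) ?_ ?_ ?_ ?_
    · rintro (u | i) hi (u' | i') hi' h
      · exact congrArg Sum.inl
          (Prod.ext_iff.1 (hlam (a₁ := (e x, u)) (a₂ := (e x, u')) h)).2
      · have := (Prod.ext_iff.1 (hlam (a₁ := (e x, u)) (a₂ := (e i', digit a (e i'))) h)).1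
        simp [← e.injective this] at hi'
      · have := (Prod.ext_iff.1 (hlam (a₁ := (e i, digit a (e i))) (a₂ := (e x, u')) h)).1
        simp [e.injective this] at hi
      · exact congrArg Sum.inr (locators_injective hlam e (digit a) h)
    · rintro (u | i) hi
      · simp at hi
      · simp only [Finset.inr_mem_disjSum, Finset.mem_sdiff, Finset.mem_univ, true_and, not_not,
          Finset.mem_insert] at hi
        by_cases hix : i = x
        · simp [vec, hix]
        · simp [vec, hix, hz i (hi.resolve_left hix)]
    · rw [Finset.card_disjSum, Finset.card_sdiff_of_subset (Finset.subset_univ _),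
        Finset.card_insert_of_notMem hxR, Finset.card_univ, Finset.card_univ, hcard,
        Fintype.card_fin]
      have : (insert x R).card ≤ Fintype.card ι := Finset.card_le_univ _
      rw [Finset.card_insert_of_notMem hxR] at this
      omega
    · intro k hk
      have hu : ∀ u, lam (e x) u ^ k * A (setDigit (e x) a u) x +
          ∑ i, lam (e i) (digit a (e i)) ^ k *
            (if i = x then 0 else A (setDigit (e x) a u) i) = 0 := by
        intro u
        have h1 := mem_yeBargCode.1 hA (setDigit (e x) a u) k hk
        have h2 : ∀ i, lam (e i) (digit (setDigit (e x) a u) (e i)) ^ k *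
            A (setDigit (e x) a u) i =
            (if i = x then lam (e x) u ^ k * A (setDigit (e x) a u) x else 0) +
            lam (e i) (digit a (e i)) ^ k * (if i = x then 0 else A (setDigit (e x) a u) i) := by
          intro i
          rw [digit_setDigit]
          by_cases hix : i = x
          · subst hix; simp
          · simp [hix]
        simp only [h2, Finset.sum_add_distrib, Finset.sum_ite_eq', Finset.mem_univ, if_true] at h1
        exact h1
      have h3 := Finset.sum_eq_zero fun u (_ : u ∈ Finset.univ) => hu u
      rw [Finset.sum_add_distrib, Finset.sum_comm] at h3
      rw [Fintype.sum_sum_type, ← h3]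
      refine congrArg₂ _ rfl (Finset.sum_congr rfl fun i _ => ?_)
      by_cases hix : i = x
      · simp [vec, hix]
      · simp [vec, loc, hix, Finset.mul_sum]
  have := congrFun hvec (Sum.inl (digit a (e x)))
  simpa [vec, setDigit_digit] using this

/-- Each helper sends one sum per class of rows. By linearity it suffices that a codeword with zero
downloads vanishes at `x`. -/
theorem canRepair_yeBargCode [DecidableEq ι] {d : ℕ}
    (hlam : Function.Injective fun p : Fin n × Fin b => lam p.1 p.2) (hb : 0 < b)
    (hbd : b + n = d + 1 + r) {x : ι} {R : Finset ι} (hxR : x ∉ R) (hR : R.card = d) :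
    CanRepair (yeBargCode r lam e) {x} R fun _ => b ^ (n - 1) := by
  obtain ⟨ρ, hρ⟩ := exists_setDigit_representatives hb (e x)
  refine canRepair_of_determines (fun _ c t => ∑ u, c (setDigit (e x) (ρ t) u))
    fun A hA B hB hAB y hy => ?_
  rw [Finset.mem_singleton] at hy
  subst hy
  funext a
  refine sub_eq_zero.1 (yeBargCode_column_eq_zero hlam hbd hxR hR (Submodule.sub_mem _ hA hB) a
    fun i hi => ?_)
  obtain ⟨t, ht⟩ := hρ a
  have h1 := congrFun (hAB ⟨i, hi⟩) t
  simp only [ht] at h1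
  simp only [Matrix.sub_apply, Finset.sum_sub_distrib]
  exact sub_eq_zero.2 h1

theorem le_sum_of_canRepair_yeBargCode [Fintype F] {d : ℕ}
    (hlam : Function.Injective fun p : Fin n × Fin b => lam p.1 p.2) (hr : r < n) (hb : 0 < b)
    (hd : n - r ≤ d) (hbd : b + n = d + 1 + r) {x : ι} {R : Finset ι} (hxR : x ∉ R)
    (hR : R.card = d) {m : R → ℕ} (hm : CanRepair (yeBargCode r lam e) {x} R m) :
    d * b ^ (n - 1) ≤ ∑ j, m j := by
  classical
  have hcard : Fintype.card ι = n := by simpa using Fintype.card_congr e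
  obtain ⟨B, -, hBc, hle⟩ := exists_subset_card_eq_sum_le m (b := b) (Finset.univ : Finset R)
    (by rw [Finset.card_univ, Fintype.card_coe]; omega)
  rw [Finset.card_univ, Fintype.card_coe, hR] at hle
  have hcut : b ^ n ≤ ∑ j ∈ B, m j := by
    refine le_sum_of_canRepair hm B fun w => ?_
    -- The column `x` and the `d - b` helpers outside `B` number `n - r`, hence form an information
    -- set: `w` can be prescribed at `x` and zero at those helpers.
    let K : Finset ι := insert x (Bᶜ.map (Function.Embedding.subtype _))
    have hK : K.card = n - r := by
      rw [Finset.card_insert_of_notMem, Finset.card_map, Finset.card_compl, hBc,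
        Fintype.card_coe, hR]
      · omega
      · simp [hxR]
    obtain ⟨A, hA, hAK⟩ := exists_mem_yeBargCode_eqOn (e := e) (r := r) hlam (T := Kᶜ)
      (by rw [Finset.card_compl, hK, hcard]; omega)
      (Matrix.of fun a i => if i = x then w a else 0)
    refine ⟨A, hA, ?_, fun j hj => ?_⟩
    · funext a
      simpa using hAK a x (by simp [K])
    · funext a
      have hjx : (j : ι) ≠ x := fun h => hxR (h ▸ j.2)
      simpa [hjx] using hAK a j (by simp [K, hj])
  obtain ⟨n, rfl⟩ : ∃ n', n = n' + 1 := ⟨n - 1, by omega⟩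
  refine Nat.le_of_mul_le_mul_left (le_trans ?_ hle) hb
  rw [Nat.add_sub_cancel]
  calc b * (d * b ^ n) = d * b ^ (n + 1) := by ring
    _ ≤ _ := Nat.mul_le_mul_left _ hcut

theorem repairBandwidth_yeBargCode [Fintype F] {d : ℕ}
    (hlam : Function.Injective fun p : Fin n × Fin b => lam p.1 p.2) (hr : r < n) (hb : 0 < b)
    (hd : n - r ≤ d) (hbd : b + n = d + 1 + r) {x : ι} {R : Finset ι} (hxR : x ∉ R)
    (hR : R.card = d) : repairBandwidth (yeBargCode r lam e) {x} R = d * b ^ (n - 1) := by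
  classical
  have hmem : d * b ^ (n - 1) ∈ {t : ℕ | ∃ m : R → ℕ,
      CanRepair (yeBargCode r lam e) {x} R m ∧ t = ∑ j, m j} :=
    ⟨_, canRepair_yeBargCode hlam hb hbd hxR hR, by simp [hR]⟩
  refine le_antisymm (Nat.sInf_le hmem) (le_csInf ⟨_, hmem⟩ ?_)
  rintro t ⟨m, hm, rfl⟩
  exact le_sum_of_canRepair_yeBargCode hlam hr hb hd hbd hxR hR hm

theorem isMSR_yeBargCode [Fintype F] {d : ℕ}
    (hlam : Function.Injective fun p : Fin n × Fin b => lam p.1 p.2) (hr0 : 0 < r) (hr : r < n)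
    (hb : 0 < b) (hd : n - r ≤ d) (hdn : d < n) (hbd : b + n = d + 1 + r) :
    IsMSR (yeBargCode r lam e) n r 1 d where
  mds := isMDSArrayCode_yeBargCode hlam hr hb
  h_pos := one_pos
  h_le := hr0
  le_d := hd
  max_bandwidth := by
    classical
    have hval : ((1 : ℕ) : ℚ) * d * (b ^ n : ℕ) / (((1 : ℕ) : ℚ) + d - n + r) =
        ((d * b ^ (n - 1) : ℕ) : ℚ) := by
      have h1 : ((1 : ℕ) : ℚ) + d - n + r = b := by
        have : (b : ℚ) + n = d + 1 + r := by exact_mod_cast hbd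
        push_cast
        linarith
      have hb' : (b : ℚ) ≠ 0 := by exact_mod_cast hb.ne'
      obtain ⟨n, rfl⟩ : ∃ n', n = n' + 1 := ⟨n - 1, by omega⟩
      rw [h1, Nat.add_sub_cancel, div_eq_iff hb']
      push_cast
      ring
    have hcard : Fintype.card ι = n := by simpa using Fintype.card_congr e
    rw [hval]
    constructor
    · let x : ι := e.symm ⟨0, by omega⟩
      obtain ⟨R, hR, hRc⟩ := Finset.exists_subset_card_eq
        (show d ≤ ((Finset.univ : Finset ι).erase x).card by
          rw [Finset.card_erase_of_mem (Finset.mem_univ _), Finset.card_univ, hcard]; omega)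
      have hxR : x ∉ R := fun h => Finset.notMem_erase x _ (hR h)
      exact ⟨{x}, R, Finset.card_singleton x, hRc, Finset.disjoint_singleton_left.2 hxR,
        by rw [repairBandwidth_yeBargCode hlam hr hb hd hbd hxR hRc]⟩
    · rintro _ ⟨X, R, hX, hR, hXR, rfl⟩
      obtain ⟨x, rfl⟩ := Finset.card_eq_one.1 hX
      rw [repairBandwidth_yeBargCode hlam hr hb hd hbd (Finset.disjoint_singleton_left.1 hXR) hR]

end YeBarg

/-! ### Exponents of the code locators -/

section Locators

theorem StrictMono.val_le_apply {m n : ℕ} {f : Fin m → Fin n} (hf : StrictMono f) (k : Fin m) :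
    (k : ℕ) ≤ f k := by
  have := Finset.card_le_card_of_injOn f (s := Finset.Iio k) (t := Finset.Iio (f k))
    (fun i hi => by simpa using hf (by simpa using hi)) hf.injective.injOn
  simpa using this

theorem StrictMono.apply_add_le_val_add {m n : ℕ} {f : Fin m → Fin n} (hf : StrictMono f)
    (k : Fin m) : (f k : ℕ) + m ≤ k + n := by
  have := Finset.card_le_card_of_injOn f (s := Finset.Ioi k) (t := Finset.Ioi (f k))
    (fun i hi => by simpa using hf (by simpa using hi)) hf.injective.injOn
  rw [Fin.card_Ioi, Fin.card_Ioi] at this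
  have h1 := k.2
  have h2 := (f k).2
  omega

/-- Two sets of `r + 1` code locators have exponent sums that differ by at most
`(r + 1) * (r * n - 1 - r)`. -/
theorem sum_exponents_le {n b r : ℕ} (hr : 0 < r) (hbr : b ≤ r) (c : Fin n → Fin b)
    {T T' : Finset (Fin n)} (hT : T.card = r + 1) (hT' : T'.card = r + 1) :
    ∑ i ∈ T, ((i : ℕ) + c i * n) ≤
      ∑ i ∈ T', ((i : ℕ) + c i * n) + (r + 1) * (r * n - 1 - r) := by
  have hn : r + 1 ≤ n := by
    rw [← hT]; simpa using Finset.card_le_univ T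
  have hsum : ∀ (S : Finset (Fin n)) (hS : S.card = r + 1) (f : Fin n → ℕ),
      ∑ i ∈ S, f i = ∑ k : Fin (r + 1), f (S.orderEmbOfFin hS k) := by
    intro S hS f
    conv_lhs => rw [← Finset.map_orderEmbOfFin_univ S hS, Finset.sum_map]
    rfl
  rw [hsum T hT, hsum T' hT']
  have hlow : ∀ k : Fin (r + 1), (k : ℕ) ≤ T'.orderEmbOfFin hT' k := fun k =>
    (T'.orderEmbOfFin hT').strictMono.val_le_apply k
  have hup : ∀ k : Fin (r + 1), (T.orderEmbOfFin hT k : ℕ) ≤ k + (n - 1 - r) := fun k => by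
    have := (T.orderEmbOfFin hT).strictMono.apply_add_le_val_add k
    omega
  -- The `k`-th smallest elements are compared: in `T` the exponent is at most `k + (n - 1 - r) + (r
  -- - 1) * n`, in `T'` at least `k`.
  calc _ ≤ ∑ k : Fin (r + 1), ((k : ℕ) + (r * n - 1 - r)) := by
        refine Finset.sum_le_sum fun k _ => ?_
        have h1 := hup k
        have h2 : (c (T.orderEmbOfFin hT k) : ℕ) * n ≤ (r - 1) * n :=
          Nat.mul_le_mul_right _ (by have := (c (T.orderEmbOfFin hT k)).2; omega)
        have h3 : (r - 1) * n + n = r * n := by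
          rw [← Nat.succ_mul, Nat.succ_eq_add_one, Nat.sub_add_cancel hr]
        omega
    _ = ∑ k : Fin (r + 1), (k : ℕ) + (r + 1) * (r * n - 1 - r) := by
        rw [Finset.sum_add_distrib]; simp
    _ ≤ _ := Nat.add_le_add_right
        (Finset.sum_le_sum fun k _ => (hlow k).trans (Nat.le_add_right _ _)) _

variable {F : Type*} [Field F]

theorem pow_ne_pow_of_lt_of_sub_lt_orderOf {β : F} (hβ : β ≠ 0) {k m : ℕ} (hkm : k < m)
    (hm : m - k < orderOf β) : β ^ k ≠ β ^ m := by
  intro h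
  have h1 : β ^ (m - k) = 1 := by
    have : β ^ k * β ^ (m - k) = β ^ k * 1 := by
      rw [← pow_add, Nat.add_sub_cancel' hkm.le, mul_one, h]
    exact mul_left_cancel₀ (pow_ne_zero _ hβ) this
  have h2 := Nat.le_of_dvd (by omega) (orderOf_dvd_of_pow_eq_one h1)
  omega

theorem ne_zero_of_orderOf_pos {β : F} (h : 0 < orderOf β) : β ≠ 0 := by
  rintro rfl
  simp at h

/-- The exponents `i + u * n` run through `0, …, b * n - 1` without repetition, by division with
remainder by `n`. -/
theorem locator_injective {n b : ℕ} {β : F} (hβ : b * n ≤ orderOf β) :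
    Function.Injective fun p : Fin n × Fin b => locator β p.1 p.2 := by
  rintro ⟨i, u⟩ ⟨i', u'⟩ h
  have hlt : ∀ (i : Fin n) (u : Fin b), (i : ℕ) + u * n < orderOf β := fun i u => by
    have h1 : ((u : ℕ) + 1) * n ≤ b * n := Nat.mul_le_mul_right _ u.2
    have h2 : ((u : ℕ) + 1) * n = u * n + n := by ring
    have := i.2
    omega
  have h1 : (i : ℕ) + u * n = i' + u' * n := pow_injOn_Iio_orderOf (hlt i u) (hlt i' u') h
  have hn : 0 < n := i.pos
  have e1 : (i : ℕ) = i' := by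
    have := congrArg (· % n) h1
    simpa [Nat.mod_eq_of_lt i.2, Nat.mod_eq_of_lt i'.2] using this
  have e2 : (u : ℕ) = u' := by
    rw [e1] at h1
    exact Nat.eq_of_mul_eq_mul_right hn (by omega)
  exact Prod.ext (Fin.ext e1) (Fin.ext e2)

theorem locator_ne_zero {n b : ℕ} {β : F} (hβ : β ≠ 0) (i : Fin n) (u : Fin b) :
    locator β i u ≠ 0 := pow_ne_zero _ hβ

end Locators

/-! ### Nonsingularity of the parity checks of a row -/

section GlobalChecks

variable {F : Type*} [Field F] {μ n b r N : ℕ} {β : F}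

theorem parityCheck_mulVec_eq_zero_iff {a : Fin (b ^ n)} {v : Fin μ × Fin n → F} :
    parityCheck μ r N β a *ᵥ v = 0 ↔
      (∀ j, ∀ k < r, ∑ i, locator β i (digit a i) ^ k * v (j, i) = 0) ∧
      ∑ j, ∑ i, locator β i (digit a i) ^ r * v (j, i) = 0 ∧
      ∑ j : Fin μ, (β ^ ((j : ℕ) * N))⁻¹ * ∑ i, (locator β i (digit a i))⁻¹ * v (j, i) = 0 := by
  have hl : ∀ j (k : Fin r), (parityCheck μ r N β a *ᵥ v) (Sum.inl (j, k)) =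
      ∑ i, locator β i (digit a i) ^ (k : ℕ) * v (j, i) := by
    intro j k
    simp [Matrix.mulVec, dotProduct, parityCheck, vandermondeCheck, Fintype.sum_prod_type]
  have h0 : (parityCheck μ r N β a *ᵥ v) (Sum.inr 0) =
      ∑ j, ∑ i, locator β i (digit a i) ^ r * v (j, i) := by
    simp [Matrix.mulVec, dotProduct, parityCheck, globalCheck, Fintype.sum_prod_type]
  have h1 : (parityCheck μ r N β a *ᵥ v) (Sum.inr 1) =
      ∑ j : Fin μ, (β ^ ((j : ℕ) * N))⁻¹ * ∑ i, (locator β i (digit a i))⁻¹ * v (j, i) := by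
    simp only [Matrix.mulVec, dotProduct, parityCheck, globalCheck, Fintype.sum_prod_type,
      Finset.mul_sum, Matrix.of_apply, zpow_neg, zpow_natCast, ← mul_assoc]
    rfl
  rw [← h0, ← h1]
  constructor
  · intro h
    exact ⟨fun j k hk => by rw [← hl j ⟨k, hk⟩, h, Pi.zero_apply], congrFun h _, congrFun h _⟩
  · rintro ⟨h2, h3, h4⟩
    funext ρ
    rcases ρ with ⟨j, k⟩ | t
    · rw [hl, h2 j k k.2, Pi.zero_apply]
    · fin_cases t
      · exact h3
      · exact h4

variable (hr : 0 < r) (hbr : b ≤ r) (hN : N = (r + 1) * (r * n - 1 - r) + 1)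
  (hβN : μ * N ≤ orderOf β) (hβn : b * n ≤ orderOf β) (hβ0 : β ≠ 0)

-- This is the nonvanishing of the 2×2 determinant. The shift by `N` exceeds any difference of
-- exponent sums, so the right exponent is larger, by less than `μ * N`.
include hr hbr hN hβN hβ0 in
theorem pow_mul_prod_locator_ne {a : Fin (b ^ n)} {j j' : Fin μ} (hj : j < j')
    {T T' : Finset (Fin n)} (hT : T.card = r + 1) (hT' : T'.card = r + 1) :
    β ^ ((j : ℕ) * N) * ∏ i ∈ T, locator β i (digit a i) ≠
      β ^ ((j' : ℕ) * N) * ∏ i ∈ T', locator β i (digit a i) := by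
  simp only [locator, Finset.prod_pow_eq_pow_sum, ← pow_add]
  have h1 := sum_exponents_le hr hbr (digit a) hT hT'
  have h2 := sum_exponents_le hr hbr (digit a) hT' hT
  have h3 : ((j : ℕ) + 1) * N ≤ j' * N := Nat.mul_le_mul_right _ hj
  have h4 : ((j' : ℕ) + 1) * N ≤ μ * N := Nat.mul_le_mul_right _ j'.2
  rw [add_mul, one_mul] at h3 h4
  exact pow_ne_pow_of_lt_of_sub_lt_orderOf hβ0 (by omega) (by omega)

include hr hbr hN hβN hβn hβ0 in
/-- The parity checks of a row detect every vector that is supported on `r` columns of each local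
group and two further columns. -/
theorem eq_zero_of_parityCheck_mulVec {a : Fin (b ^ n)} {E : Fin μ → Finset (Fin n)}
    (hE : ∀ j, (E j).card = r) {p q : Fin μ × Fin n} (hp : p.2 ∉ E p.1) (hq : q.2 ∉ E q.1)
    {v : Fin μ × Fin n → F} (hv : ∀ c, c.2 ∉ E c.1 → c ≠ p → c ≠ q → v c = 0)
    (h : parityCheck μ r N β a *ᵥ v = 0) : v = 0 := by
  classical
  obtain ⟨hloc, hg0, hg1⟩ := parityCheck_mulVec_eq_zero_iff.1 h
  set x : Fin n → F := fun i => locator β i (digit a i)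
  have hxinj : Function.Injective x :=
    locators_injective (locator_injective hβn) (Equiv.refl _) (digit a)
  have hx0 : ∀ i, x i ≠ 0 := fun i => locator_ne_zero hβ0 _ _
  have hother : ∀ j, j ≠ p.1 → j ≠ q.1 → (fun i => v (j, i)) = 0 := fun j hjp hjq =>
    eq_zero_of_moments hxinj.injOn
      (fun i hi => hv (j, i) hi (fun h => hjp (congrArg Prod.fst h))
        (fun h => hjq (congrArg Prod.fst h))) (hE j).le (hloc j)
  suffices hpq : (fun i => v (p.1, i)) = 0 ∧ (fun i => v (q.1, i)) = 0 by
    funext ⟨j, i⟩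
    by_cases hjp : j = p.1
    · subst hjp; exact congrFun hpq.1 i
    by_cases hjq : j = q.1
    · subst hjq; exact congrFun hpq.2 i
    exact congrFun (hother j hjp hjq) i
  by_cases hpq : p.1 = q.1
  · have hzero : ∀ f : Fin n → F, ∀ j, j ≠ p.1 → ∑ i, f i * v (j, i) = 0 := fun f j hj =>
      Finset.sum_eq_zero fun i _ => by
        have := congrFun (hother j hj (hpq ▸ hj)) i
        simp only [Pi.zero_apply] at this
        rw [this, mul_zero]
    rw [Finset.sum_eq_single p.1 (fun j _ hj => hzero (fun i => x i ^ r) j hj) (by simp)] at hg0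
    rw [Finset.sum_eq_single p.1
      (fun j _ hj => by rw [hzero (fun i => (x i)⁻¹) j hj, mul_zero]) (by simp)] at hg1
    replace hg1 := (mul_eq_zero.1 hg1).resolve_left (inv_ne_zero (pow_ne_zero _ hβ0))
    -- Dividing by the locators turns the orders `-1, …, r` into `0, …, r + 1`.
    have hw : (fun i => (x i)⁻¹ * v (p.1, i)) = 0 := by
      refine eq_zero_of_moments (x := x) (r := r + 2) (S := insert p.2 (insert q.2 (E p.1)))
        hxinj.injOn (fun i hi => ?_) ?_ fun k hk => ?_
      · simp only [Finset.mem_insert, not_or] at hi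
        rw [hv (p.1, i) hi.2.2 (fun h => hi.1 (congrArg Prod.snd h))
          (fun h => hi.2.1 (congrArg Prod.snd h)), mul_zero]
      · refine (Finset.card_insert_le _ _).trans (Nat.succ_le_succ ?_)
        exact (Finset.card_insert_le _ _).trans (Nat.succ_le_succ (hE _).le)
      · rcases k with _ | k
        · simpa using hg1
        · have hk' : ∑ i, x i ^ k * v (p.1, i) = 0 := by
            rcases (show k < r ∨ k = r by omega) with hk | rfl
            · exact hloc p.1 k hk
            · exact hg0
          rw [← hk']
          refine Finset.sum_congr rfl fun i _ => ?_
          rw [pow_succ, mul_assoc, mul_inv_cancel_left₀ (hx0 i)]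
    have hv0 : (fun i => v (p.1, i)) = 0 := by
      funext i
      exact (mul_eq_zero.1 (congrFun hw i)).resolve_left (inv_ne_zero (hx0 i))
    exact ⟨hv0, hpq ▸ hv0⟩
  · have hsuppp : ∀ i ∉ insert p.2 (E p.1), v (p.1, i) = 0 := fun i hi => by
      simp only [Finset.mem_insert, not_or] at hi
      exact hv (p.1, i) hi.2 (fun h => hi.1 (congrArg Prod.snd h))
        (fun h => hpq (by rw [← h]))
    have hsuppq : ∀ i ∉ insert q.2 (E q.1), v (q.1, i) = 0 := fun i hi => by
      simp only [Finset.mem_insert, not_or] at hi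
      exact hv (q.1, i) hi.2 (fun h => hpq (congrArg Prod.fst h).symm)
        (fun h => hi.1 (congrArg Prod.snd h))
    have hcp : (insert p.2 (E p.1)).card = r + 1 := by
      rw [Finset.card_insert_of_notMem hp, hE]
    have hcq : (insert q.2 (E q.1)).card = r + 1 := by
      rw [Finset.card_insert_of_notMem hq, hE]
    have hrp := moment_add_prod_mul_moment_inv hx0 hsuppp hcp (hloc p.1)
    have hrq := moment_add_prod_mul_moment_inv hx0 hsuppq hcq (hloc q.1)
    have hfin : ∀ g : Fin μ → (Fin n → F) → F, (∀ j, g j 0 = 0) →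
        ∑ j, g j (fun i => v (j, i)) =
          g p.1 (fun i => v (p.1, i)) + g q.1 (fun i => v (q.1, i)) := by
      intro g hg
      refine Finset.sum_eq_add _ _ hpq (fun j _ hj => ?_) (by simp) (by simp)
      rw [hother j hj.1 hj.2, hg]
    rw [hfin (fun _ u => ∑ i, x i ^ r * u i) (by simp)] at hg0
    rw [hfin (fun j u => (β ^ ((j : ℕ) * N))⁻¹ * ∑ i, (x i)⁻¹ * u i) (by simp)] at hg1
    have hne : β ^ ((p.1 : ℕ) * N) * ∏ i ∈ insert p.2 (E p.1), -x i ≠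
        β ^ ((q.1 : ℕ) * N) * ∏ i ∈ insert q.2 (E q.1), -x i := by
      -- Both products have `r + 1` factors, so their signs cancel.
      rw [Finset.prod_neg, Finset.prod_neg, hcp, hcq, mul_left_comm, mul_left_comm (β ^ (_ * N))]
      intro h
      have h' := mul_left_cancel₀ (pow_ne_zero _ (neg_ne_zero.2 one_ne_zero)) h
      rcases lt_or_gt_of_ne hpq with hlt | hlt
      · exact pow_mul_prod_locator_ne hr hbr hN hβN hβ0 hlt hcp hcq h'
      · exact pow_mul_prod_locator_ne hr hbr hN hβN hβ0 hlt hcq hcp h'.symm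
    have hBp : β ^ ((p.1 : ℕ) * N) ≠ 0 := pow_ne_zero _ hβ0
    have hBq : β ^ ((q.1 : ℕ) * N) ≠ 0 := pow_ne_zero _ hβ0
    have hrtop : ∑ i, x i ^ r * v (p.1, i) = 0 ∧ ∑ i, x i ^ r * v (q.1, i) = 0 := by
      generalize (∏ i ∈ insert p.2 (E p.1), -x i) = P at *
      generalize (∏ i ∈ insert q.2 (E q.1), -x i) = Q at *
      beta_reduce at hg0 hg1
      generalize (∑ i, x i ^ r * v (p.1, i)) = s at *
      generalize (∑ i, x i ^ r * v (q.1, i)) = t at *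
      generalize (∑ i, (x i)⁻¹ * v (p.1, i)) = y at *
      generalize (∑ i, (x i)⁻¹ * v (q.1, i)) = z at *
      generalize β ^ ((p.1 : ℕ) * N) = G at *
      generalize β ^ ((q.1 : ℕ) * N) = K at *
      have hy : K * y + G * z = 0 := by
        field_simp at hg1
        linear_combination hg1
      -- From `s = -P y`, `t = -Q z`, `s + t = 0` and `K y = -G z`, eliminating `s`, `t` and `z`
      -- leaves the determinant times `y`.
      have hy0 : (G * P - K * Q) * y = 0 := by
        linear_combination G * hrp - G * hg0 + G * hrq - Q * hy
      have hy1 := (mul_eq_zero.1 hy0).resolve_left (sub_ne_zero.2 hne)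
      subst hy1
      have hs : s = 0 := by linear_combination hrp
      exact ⟨hs, by linear_combination hg0 - hs⟩
    -- With moment `r` also zero, there are `r + 1` vanishing moments on `r + 1` columns.
    have hfinal : ∀ (j : Fin μ) (T : Finset (Fin n)), T.card = r + 1 →
        (∀ i ∉ T, v (j, i) = 0) → ∑ i, x i ^ r * v (j, i) = 0 → (fun i => v (j, i)) = 0 := by
      intro j T hT hTv hs
      refine eq_zero_of_moments hxinj.injOn hTv hT.le fun k hk => ?_
      rcases (show k < r ∨ k = r by omega) with hk | rfl
      · exact hloc j k hk
      · exact hs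
    exact ⟨hfinal _ _ hcp hsuppp hrtop.1, hfinal _ _ hcq hsuppq hrtop.2⟩

end GlobalChecks

/-! ### Dimension, local codes and punctured codes -/

section TwoParityCode

variable {F : Type*} [Field F] {μ n b r N : ℕ} {β : F}

theorem card_filter_snd_mem {E : Fin μ → Finset (Fin n)} (hE : ∀ j, (E j).card = r) :
    (Finset.univ.filter fun c : Fin μ × Fin n => c.2 ∈ E c.1).card = r * μ := by
  rw [Finset.card_filter, Fintype.sum_prod_type]
  simp [hE, mul_comm]

theorem mem_localGroup {j : Fin μ} {c : Fin μ × Fin n} : c ∈ localGroup μ n j ↔ c.1 = j := by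
  simp only [localGroup, Finset.mem_product, Finset.mem_singleton, Finset.mem_univ, and_true]

variable (hr : 0 < r) (hbr : b ≤ r) (hN : N = (r + 1) * (r * n - 1 - r) + 1)
  (hβN : μ * N ≤ orderOf β) (hβn : b * n ≤ orderOf β) (hβ0 : β ≠ 0)

include hr hbr hN hβN hβn hβ0

/-- The parity-check matrix of a row is nonsingular on `r` columns of each local group together with
two further columns. -/
theorem card_and_injOn_parityCheck {a : Fin (b ^ n)} {E : Fin μ → Finset (Fin n)}
    (hE : ∀ j, (E j).card = r) {p q : Fin μ × Fin n} (hp : p.2 ∉ E p.1) (hq : q.2 ∉ E q.1)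
    (hpq : p ≠ q) {S : Finset (Fin μ × Fin n)}
    (hS : S = insert p (insert q (Finset.univ.filter fun c => c.2 ∈ E c.1))) :
    S.card = Fintype.card ((Fin μ × Fin r) ⊕ Fin 2) ∧
      ∀ v : Fin μ × Fin n → F, (∀ c ∉ S, v c = 0) → parityCheck μ r N β a *ᵥ v = 0 → v = 0 := by
  subst hS
  constructor
  · rw [Finset.card_insert_of_notMem (by simp [hpq, hp]),
      Finset.card_insert_of_notMem (by simp [hq]), card_filter_snd_mem hE]
    simp [mul_comm]
  · intro v hv h
    refine eq_zero_of_parityCheck_mulVec hr hbr hN hβN hβn hβ0 hE hp hq (fun c h1 h2 h3 => ?_) h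
    exact hv c (by simp [h1, h2, h3])

theorem isArrayCode_twoParityCode (hrn : r < n) (hμ : 2 ≤ (n - r) * (μ - 1)) :
    IsArrayCode (twoParityCode μ n b r N β) (μ * n) ((n - r) * μ - 2) where
  length_eq := by simp
  finrank_eq := by
    obtain ⟨E, -, hE⟩ := Finset.exists_subset_card_eq
      (show r ≤ (Finset.univ : Finset (Fin n)).card by simpa using hrn.le)
    have hcard : 1 < ((Finset.univ : Finset (Fin μ)) ×ˢ Eᶜ).card := by
      rw [Finset.card_product, Finset.card_compl, hE, mul_comm]
      simp only [Fintype.card_fin, Finset.card_univ]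
      exact (show 1 < _ from hμ).trans_le (Nat.mul_le_mul_left _ (Nat.sub_le _ _))
    obtain ⟨p, hp, q, hq, hpq⟩ := Finset.one_lt_card.1 hcard
    rw [Finset.mem_product, Finset.mem_compl] at hp hq
    have h := finrank_rowwiseCode (H := fun a : Fin (b ^ n) => parityCheck μ r N β a)
      fun a y => by
        obtain ⟨h1, h2⟩ := card_and_injOn_parityCheck (a := a) hr hbr hN hβN hβn hβ0
          (E := fun _ => E) (fun _ => hE) hp.2 hq.2 hpq rfl
        obtain ⟨v, -, hv⟩ := exists_mulVec_eq_of_injOn h1 h2 y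
        exact ⟨v, hv⟩
    refine h.trans (congrArg (· * b ^ n) ?_)
    simp only [Fintype.card_prod, Fintype.card_sum, Fintype.card_fin]
    rw [Nat.sub_mul, mul_comm n, mul_comm r, Nat.sub_sub]

/-- Every word of the local code on group `j` extends to a codeword. -/
theorem columnsCode_twoParityCode {ι : Type*} [Fintype ι] (e : ι ≃ Fin n) (hrn : r < n)
    (hμ : 2 ≤ (n - r) * (μ - 1)) (j : Fin μ) :
    columnsCode (twoParityCode μ n b r N β) (fun x => (j, e x)) =
      yeBargCode r (locator β) e := by
  ext B
  rw [mem_yeBargCode]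
  constructor
  · rintro ⟨A, hA, rfl⟩ a k hk
    have h := (parityCheck_mulVec_eq_zero_iff.1 (mem_rowwiseCode.1 hA a)).1 j k hk
    rw [← e.sum_comp] at h
    exact h
  · intro hB
    obtain ⟨E, -, hE⟩ := Finset.exists_subset_card_eq
      (show r ≤ (Finset.univ : Finset (Fin n)).card by simpa using hrn.le)
    -- Both extra columns are taken outside group `j`, where `2 ≤ (n - r) * (μ - 1)` leaves room;
    -- group `j` then has only the `r` free columns `E`.
    have hcard : 1 < (((Finset.univ : Finset (Fin μ)).erase j) ×ˢ Eᶜ).card := by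
      rw [Finset.card_product, Finset.card_compl, hE, mul_comm,
        Finset.card_erase_of_mem (Finset.mem_univ _)]
      simpa [Nat.lt_iff_add_one_le] using hμ
    obtain ⟨p, hp, q, hq, hpq⟩ := Finset.one_lt_card.1 hcard
    rw [Finset.mem_product, Finset.mem_compl] at hp hq
    have hex : ∀ a : Fin (b ^ n), ∃ v : Fin μ × Fin n → F,
        (∀ x, v (j, e x) = B a x) ∧ parityCheck μ r N β a *ᵥ v = 0 := by
      intro a
      obtain ⟨h1, h2⟩ := card_and_injOn_parityCheck (a := a) hr hbr hN hβN hβn hβ0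
        (E := fun _ => E) (fun _ => hE) hp.2 hq.2 hpq rfl
      obtain ⟨v, hv, hv0⟩ := exists_mulVec_eq_zero_eqOn h1 h2 fun c => B a (e.symm c.2)
      refine ⟨v, fun x => ?_, hv0⟩
      -- On `E` the values of `v` are not prescribed, but they agree with `B`: the difference has
      -- `r` vanishing moments and support in `r` columns.
      have hdiff : (fun x => v (j, e x) - B a x) = 0 := by
        refine eq_zero_of_moments (x := fun x => locator β (e x) (digit a (e x))) (r := r)
          (S := E.map e.symm.toEmbedding)
          (locators_injective (locator_injective hβn) e (digit a)).injOn (fun x hx => ?_)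
          (by rw [Finset.card_map, hE]) fun k hk => ?_
        · have hxE : e x ∉ E := fun h => hx (Finset.mem_map.2 ⟨e x, h, by simp⟩)
          have hxp : (j, e x) ≠ p := fun h => Finset.ne_of_mem_erase hp.1 (by rw [← h])
          have hxq : (j, e x) ≠ q := fun h => Finset.ne_of_mem_erase hq.1 (by rw [← h])
          have := hv (j, e x) (by simp [hxE, hxp, hxq])
          simpa [sub_eq_zero] using this
        · have h3 := (parityCheck_mulVec_eq_zero_iff.1 hv0).1 j k hk
          rw [← e.sum_comp] at h3
          simp only [mul_sub, Finset.sum_sub_distrib]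
          rw [h3, hB a k hk, sub_zero]
      exact sub_eq_zero.1 (congrFun hdiff x)
    choose A hAB hA using hex
    exact ⟨A, mem_rowwiseCode.2 hA, funext fun a => funext fun x => hAB a x⟩

theorem restrictCode_localGroup_eq (hrn : r < n) (hμ : 2 ≤ (n - r) * (μ - 1)) (j : Fin μ) :
    ∃ e : localGroup μ n j ≃ Fin n, restrictCode (twoParityCode μ n b r N β) (localGroup μ n j) =
      yeBargCode r (locator β) e := by
  let e : localGroup μ n j ≃ Fin n :=
    { toFun := fun c => c.1.2
      invFun := fun i => ⟨(j, i), mem_localGroup.2 rfl⟩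
      left_inv := fun c => Subtype.ext (Prod.ext (mem_localGroup.1 c.2).symm rfl)
      right_inv := fun _ => rfl }
  refine ⟨e, ?_⟩
  rw [← columnsCode_twoParityCode hr hbr hN hβN hβn hβ0 e hrn hμ j]
  unfold restrictCode
  congr 1
  funext c
  exact Prod.ext (mem_localGroup.1 c.2) rfl

/-- A codeword which, outside `r` columns of each local group, has at most two nonzero columns
vanishes. -/
theorem twoParityCode_eq_zero {E : Fin μ → Finset (Fin n)} (hE : ∀ j, (E j).card = r)
    {R S : Finset (Fin μ × Fin n)} (hR : ∀ c, c ∈ R ↔ c.2 ∉ E c.1) (hR2 : 2 ≤ R.card)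
    (hSR : S ⊆ R) (hS : S.card ≤ 2) {A : Matrix (Fin (b ^ n)) (Fin μ × Fin n) F}
    (hA : A ∈ twoParityCode μ n b r N β) (hz : ∀ c ∈ R, c ∉ S → ∀ a, A a c = 0) : A = 0 := by
  -- `S` is padded to exactly two columns, as the nonsingularity lemma expects `p` and `q`.
  obtain ⟨T, hST, hTR, hT⟩ := Finset.exists_subsuperset_card_eq hSR hS hR2
  obtain ⟨p, q, -, rfl⟩ := Finset.card_eq_two.1 hT
  funext a
  refine eq_zero_of_parityCheck_mulVec hr hbr hN hβN hβn hβ0 hE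
    ((hR p).1 (hTR (by simp))) ((hR q).1 (hTR (by simp))) (fun c hc hcp hcq => ?_)
    (mem_rowwiseCode.1 hA a)
  refine hz c ((hR c).2 hc) (fun h => ?_) a
  have := hST h
  simp [hcp, hcq] at this

theorem isMDSArrayCode_restrictCode_twoParityCode (hb : 0 < b) (hrn : r < n)
    (hμ : 2 ≤ (n - r) * (μ - 1)) {E : Fin μ → Finset (Fin n)} (hE : ∀ j, (E j).card = r)
    {R : Finset (Fin μ × Fin n)} (hR : ∀ c, c ∈ R ↔ c.2 ∉ E c.1) :
    IsMDSArrayCode (restrictCode (twoParityCode μ n b r N β) R)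
      (μ * n - r * μ) (μ * n - r * μ - 2) (2 + 1) := by
  have hRc : R.card = μ * n - r * μ := by
    have : R = (Finset.univ.filter fun c => c.2 ∈ E c.1)ᶜ := by ext c; simp [hR]
    rw [this, Finset.card_compl, card_filter_snd_mem hE]
    simp
  have hnum : μ * n - r * μ = (n - r) * μ := by rw [Nat.sub_mul, mul_comm μ n]
  -- The punctured code must have positive dimension for the Singleton bound to produce a word of
  -- weight at most 3.
  have h3 : 3 ≤ (n - r) * μ := by
    obtain ⟨m, rfl⟩ : ∃ m, μ = m + 1 := ⟨μ - 1, by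
      rcases μ with _ | μ
      · simp at hμ
      · simp⟩
    rw [Nat.add_sub_cancel] at hμ
    rw [Nat.mul_succ]
    omega
  -- Erasing `r` columns per group loses no codeword, so the dimension is unchanged.
  have hinj : Function.Injective
      ((selectColumns F (b ^ n) (fun c : R => (c : Fin μ × Fin n))).domRestrict
        (twoParityCode μ n b r N β)) := by
    rw [← LinearMap.ker_eq_bot, LinearMap.ker_eq_bot']
    rintro ⟨A, hA⟩ h
    refine Subtype.ext (twoParityCode_eq_zero hr hbr hN hβN hβn hβ0 hE hR (by omega)
      (Finset.empty_subset R) (by simp) hA fun c hc _ a => ?_)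
    exact congrFun (congrFun h a) ⟨c, hc⟩
  refine isMDSArrayCode_of_le_columnWeight ⟨by rw [Fintype.card_coe, hRc], ?_⟩ (by omega)
    (Nat.pow_pos hb) (by omega) ?_
  · have h := LinearMap.finrank_range_of_inj hinj
    rw [LinearMap.range_domRestrict,
      (isArrayCode_twoParityCode hr hbr hN hβN hβn hβ0 hrn hμ).finrank_eq] at h
    rw [hnum]
    exact h
  · rintro B ⟨A, hA, rfl⟩ hB0
    by_contra hlt
    obtain ⟨S, hS, hSz⟩ := exists_card_eq_columnWeight
      (selectColumns F (b ^ n) (fun c : R => (c : Fin μ × Fin n)) A)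
    refine hB0 ?_
    rw [twoParityCode_eq_zero hr hbr hN hβN hβn hβ0 hE hR (by omega)
      (S := S.map (Function.Embedding.subtype _)) (fun c hc => ?_)
      (by rw [Finset.card_map]; omega) hA fun c hc hcS a => ?_, map_zero]
    · obtain ⟨c', -, rfl⟩ := Finset.mem_map.1 hc
      exact c'.2
    · exact hSz ⟨c, hc⟩ (fun h => hcS (Finset.mem_map.2 ⟨_, h, rfl⟩)) a

end TwoParityCode

/-! ### Assembly of the PMDS, MSR and Ye–Barg properties -/

theorem isPMDSWith_twoParityCode {F : Type*} [Field F] {μ n b r N : ℕ} {β : F} (hr : 0 < r)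
    (hb : 0 < b) (hbr : b ≤ r) (hN : N = (r + 1) * (r * n - 1 - r) + 1)
    (hβN : μ * N ≤ orderOf β) (hβn : b * n ≤ orderOf β) (hβ0 : β ≠ 0) (hrn : r < n)
    (hμ : 2 ≤ (n - r) * (μ - 1)) :
    IsPMDSWith (twoParityCode μ n b r N β) μ n r 2 (localGroup μ n) where
  μ_pos := by
    rcases μ with _ | μ
    · simp at hμ
    · exact Nat.succ_pos _
  n_pos := by omega
  r_pos := hr
  s_pos := two_pos
  ℓ_pos := Nat.pow_pos hb
  r_le := hrn.le
  s_le := hμ.trans (Nat.mul_le_mul_left _ (Nat.sub_le _ _))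
  isArrayCode := isArrayCode_twoParityCode hr hbr hN hβN hβn hβ0 hrn hμ
  card_part j := by simp [localGroup]
  disjoint_parts i j hij := by
    refine Finset.disjoint_left.2 fun c hi hj => hij ?_
    exact (mem_localGroup.1 hi).symm.trans (mem_localGroup.1 hj)
  union_parts := by ext c; simp [localGroup]
  local_mds j := by
    obtain ⟨e, he⟩ := restrictCode_localGroup_eq hr hbr hN hβN hβn hβ0 hrn hμ j
    rw [he]
    exact isMDSArrayCode_yeBargCode (locator_injective hβn) hrn hb
  global_mds E hEW hE := by
    have hmem : ∀ j, ∀ c ∈ E j, c.1 = j := fun j c hc => mem_localGroup.1 (hEW j hc)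
    refine isMDSArrayCode_restrictCode_twoParityCode hr hbr hN hβN hβn hβ0 hb hrn hμ
      (E := fun j => (E j).image Prod.snd) (fun j => ?_) fun c => ?_
    · rw [Finset.card_image_of_injOn, hE]
      intro c hc c' hc' h
      exact Prod.ext ((hmem j c hc).trans (hmem j c' hc').symm) h
    · simp only [Finset.mem_sdiff, Finset.mem_univ, true_and, Finset.mem_biUnion,
        Finset.mem_image, not_iff_not]
      constructor
      · rintro ⟨j, hj⟩
        exact ⟨c, by rwa [hmem j c hj], rfl⟩
      · rintro ⟨c', hc', h⟩
        refine ⟨c.1, ?_⟩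
        rwa [show c' = c from Prod.ext (hmem _ _ hc') h] at hc'

theorem mainTheorem1 {F : Type*} [Field F] [Fintype F] [CharP F 2]
    (μ n r d b N : ℕ) (hr : 0 < r) (hrn : r ≤ n)
    (hs : 2 ≤ (n - r) * (μ - 1))
    (hd : n - r ≤ d) (hdn : d < n)
    (hb : b = d + 1 - (n - r))
    (hN : N = (r + 1) * (r * n - 1 - r) + 1)
    (hq : max (μ * N) (b * n) ≤ Fintype.card F)
    (β : F) (hβ : max (μ * N) (b * n) ≤ orderOf β) :
    IsLocallyMSRPMDS (twoParityCode μ n b r N β) μ n r 2 1 d (localGroup μ n) ∧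
      ∀ j : Fin μ, IsYeBarg (columnsCode (twoParityCode μ n b r N β) (fun i => (j, i))) r d := by
  have hrn' : r < n := by
    refine lt_of_le_of_ne hrn ?_
    rintro rfl
    simp at hs
  have hb0 : 0 < b := by omega
  have hbr : b ≤ r := by omega
  have hbd : b + n = d + 1 + r := by omega
  have hβN : μ * N ≤ orderOf β := (le_max_left _ _).trans hβ
  have hβn : b * n ≤ orderOf β := (le_max_right _ _).trans hβ
  have hβ0 : β ≠ 0 := ne_zero_of_orderOf_pos ((Nat.mul_pos hb0 (by omega)).trans_le hβn)
  have hlam := locator_injective hβn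
  refine ⟨⟨isPMDSWith_twoParityCode hr hb0 hbr hN hβN hβn hβ0 hrn' hs, fun j => ?_⟩, fun j => ?_⟩
  -- The restricted code is indexed by a subtype, hence the relabelling `e`; the Ye–Barg claim below
  -- keeps the natural order of columns.
  · obtain ⟨e, he⟩ := restrictCode_localGroup_eq hr hbr hN hβN hβn hβ0 hrn' hs j
    rw [he]
    exact isMSR_yeBargCode hlam hr hrn' hb0 hd hdn hbd
  · have h := columnsCode_twoParityCode hr hbr hN hβN hβn hβ0 (Equiv.refl _) hrn' hs j
    simp only [Equiv.refl_apply] at h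
    rw [h]
    exact ⟨hbd, isArrayCode_yeBargCode hlam hrn, locator β, hlam, rfl⟩
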